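/- Let $K$ be a number field with ring of integers $\mathcal O_K$, and let $\overline V$ be a hermitian vector bundle of rank $N+1$ ($N\ge 0$) over $\operatorname{Spec}\mathcal O_K$: a finitely generated projective $\mathcal O_K$-module $V$ of rank $N+1$ together with, for every embedding $\sigma: K\hookrightarrow\mathbb C$, a (positive definite) hermitian scalar product on $V_\sigma=V\otimes_{\mathcal O_K,\sigma}\mathbb C$, with associated norm $\|\cdot\|_\sigma$, these scalar products being invariant under complex conjugation. Let $\lambda_{\max}(\overline V)=\lambda_{N+1}(\overline V)$ be the last successive minimum, i.e. the infimum of the real numbers $\lambda$ for which there exist vectors $e_1,\dots,e_{N+1}\in V$, linearly independent in $V_K=V\otimes_{\mathcal O_K}K$, such that $\log\|e_i\|_\sigma\le\lambda$ for all $i$ and all $\sigma: K\hookrightarrow\mathbb C$. Let $\mathbb P_K=\operatorname{Proj}(\operatorname{Sym}(V_K^*))$ be the projective space of lines in $V_K$, and let $\Sigma\subsetneq\mathbb P_K$ be a closed subvariety (integral, i.e. irreducible over $K$ and reduced), different from $\mathbb P_K$, of projective degree $D$ (that is, its Hilbert polynomial has leading term $\frac{D}{r!}t^r$, where $r=\dim\Sigma$).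 Then there exists a nonzero vector $v\in V$ such that, for all $\sigma: K\hookrightarrow\mathbb C$, $$\log\|v\|_\sigma\le\lambda_{\max}(\overline V)+\log\bigl(D(N+1)\bigr),$$ and such that the point $[v]\in\mathbb P_K(K)$ does not lie in $\Sigma(K)$. -/

import Mathlib

open scoped TensorProduct NumberField LinearAlgebra.Projectivization Nat

noncomputable section

/-! ### Hermitian vector bundles over the spectrum of a ring of integers -/

/-- A copy of the field `ℂ`, regarded as an algebra over `𝓞 K` through the embedding `σ`. -/
def ComplexAt {K : Type*} [Field K] (_σ : K →+* ℂ) : Type := ℂ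

namespace ComplexAt

variable {K : Type*} [Field K] (σ : K →+* ℂ)

instance : Field (ComplexAt σ) := inferInstanceAs (Field ℂ)

instance : Algebra ℂ (ComplexAt σ) := inferInstanceAs (Algebra ℂ ℂ)

instance : Algebra (𝓞 K) (ComplexAt σ) :=
  RingHom.toAlgebra (S := ComplexAt σ) (σ.comp (algebraMap (𝓞 K) K))

/-- Complex conjugation, as an `𝓞 K`-linear map from `ℂ` (via `σ`) to `ℂ` (via the conjugate
embedding). -/
def conjMap : ComplexAt σ →ₗ[𝓞 K] ComplexAt (NumberField.ComplexEmbedding.conjugate σ) where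
  toFun z := (starRingEnd ℂ z : ℂ)
  map_add' x y := map_add (starRingEnd ℂ) x y
  map_smul' a x := map_mul (starRingEnd ℂ) (σ (algebraMap (𝓞 K) K a)) x

end ComplexAt

/-- The complex vector space `V_σ = ℂ ⊗ V`, the tensor product being over `𝓞 K` via `σ`. -/
abbrev ComplexFiber {K : Type*} [Field K] (σ : K →+* ℂ)
    (V : Type*) [AddCommGroup V] [Module (𝓞 K) V] : Type _ :=
  ComplexAt σ ⊗[𝓞 K] V

/-- The conjugation `z ⊗ v ↦ conj z ⊗ v` from `V_σ` to the fiber at the conjugate embedding. -/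
def ComplexFiber.conj {K : Type*} [Field K] (σ : K →+* ℂ)
    (V : Type*) [AddCommGroup V] [Module (𝓞 K) V] :
    ComplexFiber σ V →ₗ[𝓞 K] ComplexFiber (NumberField.ComplexEmbedding.conjugate σ) V :=
  LinearMap.rTensor V (ComplexAt.conjMap σ)

/-- A hermitian metric on the `𝓞 K`-module `V`: a (positive definite) hermitian scalar product on
`V_σ` for every complex embedding `σ`, the family being invariant under complex conjugation.
A hermitian vector bundle over `Spec (𝓞 K)` is a finitely generated projective module `V` with
such a metric. -/
structure HermitianMetric (K : Type*) [Field K]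
    (V : Type*) [AddCommGroup V] [Module (𝓞 K) V] where
  /-- The scalar product at `σ`. -/
  form : ∀ σ : K →+* ℂ, InnerProductSpace.Core ℂ (ComplexFiber σ V)
  conj_invariant : ∀ (σ : K →+* ℂ) (x y : ComplexFiber σ V),
    (form (NumberField.ComplexEmbedding.conjugate σ)).inner
        (ComplexFiber.conj σ V x) (ComplexFiber.conj σ V y) =
      starRingEnd ℂ ((form σ).inner x y)

namespace HermitianMetric

variable {K : Type*} [Field K] {V : Type*} [AddCommGroup V] [Module (𝓞 K) V]

/-- The norm `‖v‖_σ` of (the image in `V_σ` of) an element `v` of `V`. -/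
def norm (h : HermitianMetric K V) (σ : K →+* ℂ) (v : V) : ℝ :=
  Real.sqrt ((h.form σ).inner ((1 : ComplexAt σ) ⊗ₜ[𝓞 K] v) ((1 : ComplexAt σ) ⊗ₜ[𝓞 K] v)).re

/-- The `p`-th (logarithmic) successive minimum of `(V, h)`. -/
def successiveMinimum (h : HermitianMetric K V) (p : ℕ) : ℝ :=
  sInf {l : ℝ | ∃ e : Fin p → V,
    LinearIndependent K (fun i => (1 : K) ⊗ₜ[𝓞 K] e i) ∧
    ∀ (i : Fin p) (σ : K →+* ℂ), Real.log (h.norm σ (e i)) ≤ l}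

end HermitianMetric

/-! ### Subvarieties of the projective space `Proj (Sym (W^*))` of lines in `W` -/

/-- The homogeneous coordinate ring `Sym (W^*)` of the projective space of lines in `W`. -/
abbrev CoordRing (K : Type*) [Field K] (W : Type*) [AddCommGroup W] [Module K W] : Type _ :=
  SymmetricAlgebra K (Module.Dual K W)

namespace CoordRing

variable (K : Type*) [Field K] (W : Type*) [AddCommGroup W] [Module K W]

/-- `Sym^n (W^*)`: the forms of degree `n`, spanned by the products of `n` linear forms. -/
def forms (n : ℕ) : Submodule K (CoordRing K W) :=
  (LinearMap.range (SymmetricAlgebra.ι K (Module.Dual K W))) ^ n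

variable {K W}

/-- The value of a polynomial function at a vector. -/
def evalAt (w : W) : CoordRing K W →ₐ[K] K :=
  SymmetricAlgebra.lift (Module.Dual.eval K W w)

end CoordRing

/-- A closed subvariety (integral closed subscheme) of `Proj (Sym (W^*))`, given by its
homogeneous ideal: a homogeneous prime ideal that does not contain all the linear forms. It is
irreducible over `K`, but not necessarily geometrically irreducible. -/
structure ProjSubvariety (K : Type*) [Field K] (W : Type*) [AddCommGroup W] [Module K W] where
  /-- The ideal generated by the forms vanishing on the subvariety. -/
  ideal : Ideal (CoordRing K W)
  isPrime : ideal.IsPrime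
  homogeneous : ideal = Ideal.span {f | f ∈ ideal ∧ ∃ n : ℕ, f ∈ CoordRing.forms K W n}
  relevant : ∃ l : Module.Dual K W, SymmetricAlgebra.ι K (Module.Dual K W) l ∉ ideal

namespace ProjSubvariety

variable {K : Type*} [Field K] {W : Type*} [AddCommGroup W] [Module K W]

/-- The subvariety is not the whole projective space. -/
def IsProper (Z : ProjSubvariety K W) : Prop := Z.ideal ≠ ⊥

/-- The set of `K`-rational points: the lines in `W` on which every element of the ideal
vanishes. -/
def rationalPoints (Z : ProjSubvariety K W) : Set (ℙ K W) :=
  {x | ∀ f ∈ Z.ideal, ∀ w ∈ x.submodule, CoordRing.evalAt w f = 0}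

/-- The Hilbert function: the dimension of the degree `n` part of the homogeneous coordinate ring
of the subvariety. -/
def hilbertFunction (Z : ProjSubvariety K W) (n : ℕ) : ℕ :=
  Module.finrank K
    ((CoordRing.forms K W n).map (Ideal.Quotient.mkₐ K Z.ideal).toLinearMap)

/-- The projective degree is `D`: the Hilbert polynomial has leading coefficient `D / r!`, where
`r` is its degree (the dimension of the subvariety). -/
def HasDegree (Z : ProjSubvariety K W) (D : ℕ) : Prop :=
  ∃ p : Polynomial ℚ,
    (∀ᶠ n : ℕ in Filter.atTop, (Z.hilbertFunction n : ℚ) = p.eval (n : ℚ)) ∧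
    p.leadingCoeff * (p.natDegree ! : ℚ) = D

end ProjSubvariety

end

/-!
Let `I ⊆ K[x₀, …, x_N]` be the homogeneous prime ideal of `Σ`, in coordinates given by linearly
independent vectors `e₀, …, e_N` of almost minimal norm. The point is that `I` contains a nonzero
polynomial `F` of degree at most `D`. Let `A = K[x] / I`, of transcendence degree `s`, and let `A≤n`
be the image in `A` of the polynomials of degree at most `n`. Choose coordinates whose images form a
transcendence basis of `A`, together with one more coordinate. By Gauss's lemma, the relations
between the images of these `s + 1` coordinates are the multiples of a single polynomial `F`, of
degree `e` say, and counting monomials gives `e * (n + s).choose s ≤ dim A≤(n + e)`. On the other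
hand `dim A≤n` is a sum of values of the Hilbert function, hence equivalent to
`D * n ^ (r + 1) / (r + 1)!`, where `r = dim Σ`, and by Noether normalization it is `O(n ^ s)`.
Therefore `s ≥ r + 1`, and the comparison of both estimates gives `e ≤ D`.

By the combinatorial Nullstellensatz, `F` does not vanish at some point `(a₀, …, a_N)` with natural
coordinates of sum at most `D`; the vector `v = ∑ aᵢ eᵢ` then avoids `Σ`, and the triangle
inequality bounds its norms. The factor `N + 1 ≥ 2` leaves room for the infimum in the definition of
the last successive minimum not to be attained.
-/

section Growth

open Filter Topology Asymptotics

lemma tendsto_sum_range_div_sum_range {f g : ℕ → ℝ} {L : ℝ} (hg : ∀ n, 0 < g n)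
    (hg' : Tendsto (fun n => ∑ m ∈ Finset.range n, g m) atTop atTop)
    (hfg : Tendsto (fun n => f n / g n) atTop (𝓝 L)) :
    Tendsto (fun n => (∑ m ∈ Finset.range n, f m) / ∑ m ∈ Finset.range n, g m) atTop (𝓝 L) := by
  have hlittle : (fun n => f n - L * g n) =o[atTop] g := by
    refine (isLittleO_iff_tendsto fun n hn => absurd hn (hg n).ne').mpr ?_
    refine (tendsto_sub_nhds_zero_iff.mpr hfg).congr fun n => ?_
    rw [sub_div, mul_div_cancel_right₀ _ (hg n).ne']
  have hsum := (hlittle.sum_range (fun n => (hg n).le) hg').tendsto_div_nhds_zero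
  refine tendsto_sub_nhds_zero_iff.mp (hsum.congr' ?_)
  filter_upwards [hg'.eventually_gt_atTop 0] with n hn
  rw [Finset.sum_sub_distrib, ← Finset.mul_sum, sub_div, mul_div_cancel_right₀ _ hn.ne']

lemma isEquivalent_add_choose (a k : ℕ) :
    (fun n : ℕ => ((n + a).choose k : ℝ)) ~[atTop] fun n : ℕ => (n : ℝ) ^ k / k ! := by
  have hshift : (fun n : ℕ => (n : ℝ) + a) ~[atTop] fun n : ℕ => (n : ℝ) :=
    IsEquivalent.refl.add_isLittleO
      ((isLittleO_const_left.mpr (Or.inr (tendsto_norm_atTop_atTop.comp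
        tendsto_natCast_atTop_atTop))))
  have hchoose := (isEquivalent_choose k).comp_tendsto (tendsto_add_atTop_nat a)
  simp only [Function.comp_def, Nat.cast_add] at hchoose
  exact hchoose.trans ((hshift.pow k).div IsEquivalent.refl)

lemma tendsto_add_choose_div_add_choose (a b k : ℕ) :
    Tendsto (fun n : ℕ => ((n + a).choose k : ℝ) / (n + b + k).choose k) atTop (𝓝 1) := by
  have hequiv := (isEquivalent_add_choose a k).trans (isEquivalent_add_choose (b + k) k).symm
  simp only [← add_assoc] at hequiv
  refine (isEquivalent_iff_tendsto_one (Eventually.of_forall fun n => ?_)).mp hequiv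
  exact_mod_cast (Nat.choose_pos (Nat.le_add_left k (n + b))).ne'

lemma tendsto_eval_div_choose (p : Polynomial ℝ) :
    Tendsto (fun n : ℕ => p.eval (n : ℝ) / (n + p.natDegree).choose p.natDegree) atTop
      (𝓝 (p.leadingCoeff * p.natDegree !)) := by
  have hp := p.isEquivalent_atTop_lead.comp_tendsto (tendsto_natCast_atTop_atTop (R := ℝ))
  refine (hp.div (isEquivalent_add_choose p.natDegree p.natDegree)).symm.tendsto_nhds
    (tendsto_const_nhds.congr' ?_)
  filter_upwards [eventually_ne_atTop 0] with n hn
  have : (n : ℝ) ≠ 0 := Nat.cast_ne_zero.mpr hn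
  simp only [Pi.div_apply, Function.comp_apply]
  field_simp

lemma tendsto_sum_range_div_choose {h : ℕ → ℝ} {p : Polynomial ℝ}
    (hp : ∀ᶠ n : ℕ in atTop, h n = p.eval (n : ℝ)) :
    Tendsto (fun n : ℕ => (∑ m ∈ Finset.range (n + 1), h m) /
      (n + p.natDegree + 1).choose (p.natDegree + 1)) atTop
      (𝓝 (p.leadingCoeff * p.natDegree !)) := by
  have hpos (n : ℕ) : 1 ≤ (n + p.natDegree).choose p.natDegree :=
    Nat.choose_pos (Nat.le_add_left _ n)
  have hdiv : Tendsto (fun n => ∑ m ∈ Finset.range n,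
      ((m + p.natDegree).choose p.natDegree : ℝ)) atTop atTop := by
    refine tendsto_atTop_mono (fun n => ?_) (tendsto_natCast_atTop_atTop (R := ℝ))
    simpa using Finset.card_nsmul_le_sum (Finset.range n) _ (1 : ℝ)
      fun m _ => Nat.one_le_cast.mpr (hpos m)
  have hlim := (tendsto_sum_range_div_sum_range (f := h) (fun n => Nat.cast_pos.mpr (hpos n)) hdiv
    ((tendsto_eval_div_choose p).congr' (hp.mono fun n hn => by simp only [hn]))).comp
      (tendsto_add_atTop_nat 1)
  refine hlim.congr fun n => ?_
  rw [Function.comp_apply, ← Nat.sum_range_add_choose, Nat.cast_sum]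

lemma natDegree_lt_of_sum_range_isBigO {h : ℕ → ℝ} {p : Polynomial ℝ} {s : ℕ} (hp0 : p ≠ 0)
    (hp : ∀ᶠ n : ℕ in atTop, h n = p.eval (n : ℝ))
    (hs : (fun n => ∑ m ∈ Finset.range (n + 1), h m) =O[atTop] fun n : ℕ => (n : ℝ) ^ s) :
    p.natDegree < s := by
  by_contra! hle
  set d := p.natDegree
  have hpow : (fun n : ℕ => (n : ℝ) ^ s) =o[atTop] fun n : ℕ => (n : ℝ) ^ (d + 1) :=
    (isLittleO_pow_pow_atTop_of_lt (Nat.lt_succ_of_le hle)).comp_tendsto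
      tendsto_natCast_atTop_atTop
  have hchoose : (fun n : ℕ => (n : ℝ) ^ (d + 1)) =O[atTop]
      fun n : ℕ => ((n + d + 1).choose (d + 1) : ℝ) := by
    refine IsBigO.trans ?_ (isEquivalent_add_choose (d + 1) (d + 1)).isBigO_symm
    simp only [div_eq_mul_inv, mul_comm _ (((d + 1) ! : ℝ)⁻¹)]
    exact (isBigO_refl _ _).const_mul_right (inv_ne_zero (by positivity))
  have hzero := tendsto_nhds_unique (tendsto_sum_range_div_choose hp)
    ((hs.trans_isLittleO hpow).trans_isBigO hchoose).tendsto_div_nhds_zero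
  have hfac : (d ! : ℝ) ≠ 0 := Nat.cast_ne_zero.mpr d.factorial_ne_zero
  exact hp0 (Polynomial.leadingCoeff_eq_zero.mp ((mul_eq_zero.mp hzero).resolve_right hfac))

lemma le_leadingCoeff_mul_factorial_of_le_sum_range {h : ℕ → ℝ} {p : Polynomial ℝ} {e s : ℕ}
    (hp : ∀ᶠ n : ℕ in atTop, h n = p.eval (n : ℝ)) (hs : p.natDegree < s)
    (hle : ∀ n, (e * (n + s).choose s : ℝ) ≤ ∑ m ∈ Finset.range (n + e + 1), h m) :
    (e : ℝ) ≤ p.leadingCoeff * p.natDegree ! := by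
  set d := p.natDegree with hd
  have hlow := (tendsto_add_choose_div_add_choose (d + 1) e (d + 1)).const_mul (e : ℝ)
  rw [mul_one] at hlow
  refine le_of_tendsto_of_tendsto' hlow
    ((tendsto_sum_range_div_choose hp).comp (tendsto_add_atTop_nat e)) fun n => ?_
  have hmono : (n + (d + 1)).choose (d + 1) ≤ (n + s).choose s := by
    rw [← Nat.choose_symm_add, ← Nat.choose_symm_add]
    exact Nat.choose_le_choose n (by omega)
  rw [Function.comp_apply, ← mul_div_assoc, ← hd, add_assoc (n + e) d 1]
  gcongr
  exact (mul_le_mul_of_nonneg_left (Nat.cast_le.mpr hmono) e.cast_nonneg).trans (hle n)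

end Growth

section BoundedDegree

open MvPolynomial

lemma card_finsupp_sum_le (σ : Type*) [Fintype σ] (n : ℕ) :
    Nat.card {d : σ →₀ ℕ | (d.sum fun _ e => e) ≤ n} = (n + Fintype.card σ).choose n := by
  classical
  have hcard : ∑ m ∈ Finset.range (n + 1), ((Finset.univ : Finset σ).finsuppAntidiag m).card =
      (n + Fintype.card σ).choose n := by
    induction n with
    | zero => simp [Finset.card_finsuppAntidiag_nat_eq_choose]
    | succ n ih =>
      rw [Finset.sum_range_succ, ih, Finset.card_finsuppAntidiag_nat_eq_choose, Finset.card_univ,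
        show Fintype.card σ + (n + 1) - 1 = n + Fintype.card σ by omega,
        show n + 1 + Fintype.card σ = (n + Fintype.card σ) + 1 by omega, Nat.choose_succ_succ']
  have hset : {d : σ →₀ ℕ | (d.sum fun _ e => e) ≤ n} =
      ((Finset.range (n + 1)).biUnion Finset.univ.finsuppAntidiag : Finset (σ →₀ ℕ)) := by
    ext d
    simp [Finset.mem_finsuppAntidiag, Finsupp.sum_fintype]
  rw [hset, Nat.card_coe_set_eq, Set.ncard_coe_finset, Finset.card_biUnion, hcard]
  exact fun a _ b _ hab => Finset.disjoint_left.mpr fun d ha hb =>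
    hab ((Finset.mem_finsuppAntidiag.mp ha).1.symm.trans (Finset.mem_finsuppAntidiag.mp hb).1)

lemma finrank_restrictTotalDegree (σ R : Type*) [Fintype σ] [CommRing R] [Nontrivial R] (n : ℕ) :
    Module.finrank R (restrictTotalDegree σ R n) = (n + Fintype.card σ).choose n := by
  rw [← card_finsupp_sum_le]
  exact Module.finrank_eq_nat_card_basis (basisRestrictSupport R _)

variable {σ R A : Type*} [CommSemiring R] [CommSemiring A] [Algebra R A]

lemma restrictTotalDegree_mono : Monotone (restrictTotalDegree σ R) := fun m n h f hf => by
  rw [mem_restrictTotalDegree] at hf ⊢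
  exact hf.trans h

lemma restrictTotalDegree_mul_le (m n : ℕ) :
    restrictTotalDegree σ R m * restrictTotalDegree σ R n ≤ restrictTotalDegree σ R (m + n) := by
  rw [Submodule.mul_le]
  intro f hf g hg
  rw [mem_restrictTotalDegree] at hf hg ⊢
  exact (totalDegree_mul f g).trans (add_le_add hf hg)

lemma homogeneousSubmodule_le_restrictTotalDegree (n : ℕ) :
    homogeneousSubmodule σ R n ≤ restrictTotalDegree σ R n := fun _ hf =>
  (mem_restrictTotalDegree _ _ _).mpr (IsHomogeneous.totalDegree_le hf)

lemma restrictTotalDegree_le_pow (n : ℕ) :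
    restrictTotalDegree σ R n ≤ restrictTotalDegree σ R 1 ^ n := by
  have hone : (1 : Submodule R (MvPolynomial σ R)) ≤ restrictTotalDegree σ R 1 := by
    rw [Submodule.one_le, mem_restrictTotalDegree, totalDegree_one]
    exact zero_le_one
  intro f hf
  rw [mem_restrictTotalDegree] at hf
  rw [← support_sum_monomial_coeff f]
  refine Submodule.sum_mem _ fun d hd => ?_
  exact pow_le_pow_right' hone ((le_totalDegree hd).trans hf)
    (pow_le_pow_left' (homogeneousSubmodule_le_restrictTotalDegree 1) d.degree
      (monomial_mem_homogeneousSubmodule_pow_degree (coeff d f) d))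

/-- The elements of an algebra which are polynomials of degree at most `n` in a given family of
elements, the family being encoded by its evaluation map `u`: the filtration of the algebra by
degree. -/
noncomputable def imageDegreeLE (u : MvPolynomial σ R →ₐ[R] A) (n : ℕ) : Submodule R A :=
  (restrictTotalDegree σ R n).map u.toLinearMap

lemma map_mem_imageDegreeLE (u : MvPolynomial σ R →ₐ[R] A) {f : MvPolynomial σ R} {n : ℕ}
    (hf : f.totalDegree ≤ n) : u f ∈ imageDegreeLE u n :=
  ⟨f, (mem_restrictTotalDegree _ _ _).mpr hf, rfl⟩

lemma imageDegreeLE_mul_le (u : MvPolynomial σ R →ₐ[R] A) (m n : ℕ) :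
    imageDegreeLE u m * imageDegreeLE u n ≤ imageDegreeLE u (m + n) := by
  rw [imageDegreeLE, imageDegreeLE, ← Submodule.map_mul]
  exact Submodule.map_mono (restrictTotalDegree_mul_le m n)

lemma imageDegreeLE_le_pow (u : MvPolynomial σ R →ₐ[R] A) (n : ℕ) :
    imageDegreeLE u n ≤ imageDegreeLE u 1 ^ n := by
  rw [imageDegreeLE, imageDegreeLE, ← Submodule.map_pow]
  exact Submodule.map_mono (restrictTotalDegree_le_pow n)

lemma imageDegreeLE_comp_rename_le {τ : Type*} (u : MvPolynomial σ R →ₐ[R] A) (c : τ → σ) (n : ℕ) :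
    imageDegreeLE (u.comp (rename c)) n ≤ imageDegreeLE u n := by
  rintro _ ⟨f, hf, rfl⟩
  exact map_mem_imageDegreeLE u
    ((totalDegree_rename_le c f).trans ((mem_restrictTotalDegree _ _ _).mp hf))

end BoundedDegree

section UpperBound

open MvPolynomial Filter Asymptotics

variable {σ τ K A : Type*} [Field K] [CommRing A] [Algebra K A]

lemma finrank_mul_le (M N : Submodule K A) [Module.Finite K M] [Module.Finite K N] :
    Module.finrank K (M * N : Submodule K A) ≤ Module.finrank K M * Module.finrank K N := by
  rw [← Module.finrank_tensorProduct (R := K), ← Submodule.mulMap_range]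
  exact LinearMap.finrank_range_le _

instance [Finite σ] (u : MvPolynomial σ K →ₐ[K] A) (n : ℕ) : Module.Finite K (imageDegreeLE u n) :=
  inferInstanceAs (Module.Finite K ((restrictTotalDegree σ K n).map u.toLinearMap))

lemma finrank_imageDegreeLE_le [Fintype σ] (u : MvPolynomial σ K →ₐ[K] A) (n : ℕ) :
    Module.finrank K (imageDegreeLE u n) ≤ (n + Fintype.card σ) ^ Fintype.card σ := by
  refine (Submodule.finrank_map_le _ _).trans ?_
  rw [finrank_restrictTotalDegree, Nat.choose_symm_add]
  exact Nat.choose_le_pow _ _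

lemma exists_fg_forall_fg_le_imageDegreeLE_mul {g : MvPolynomial τ K →ₐ[K] A} (hg : g.Finite) :
    ∃ G : Submodule K A, G.FG ∧ 1 ≤ G ∧
      ∀ X : Submodule K A, X.FG → ∃ M, X ≤ imageDegreeLE g M * G := by
  classical
  algebraize [g.toRingHom]
  have : Module.Finite (MvPolynomial τ K) A := hg
  obtain ⟨S, hS⟩ := Module.Finite.fg_top (R := MvPolynomial τ K) (M := A)
  have hmem (a : A) : ∃ M, a ∈ imageDegreeLE g M * Submodule.span K (insert 1 S : Finset A) := by
    obtain ⟨f, -, rfl⟩ := Submodule.mem_span_finset.mp (hS ▸ Submodule.mem_top (x := a))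
    refine ⟨S.sup fun s => (f s).totalDegree, Submodule.sum_mem _ fun s hs => ?_⟩
    rw [Algebra.smul_def]
    exact Submodule.mul_mem_mul
      (map_mem_imageDegreeLE g (Finset.le_sup (f := fun s => (f s).totalDegree) hs))
      (Submodule.subset_span (Finset.mem_insert_of_mem hs))
  choose M hM using hmem
  refine ⟨Submodule.span K (insert 1 S : Finset A), ⟨_, rfl⟩,
    Submodule.one_le.mpr (Submodule.subset_span (Finset.mem_insert_self _ _)), ?_⟩
  rintro _ ⟨T, rfl⟩
  refine ⟨T.sup M, Submodule.span_le.mpr fun a ha => ?_⟩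
  exact mul_le_mul' (Submodule.map_mono (restrictTotalDegree_mono (Finset.le_sup ha))) le_rfl (hM a)

lemma pow_le_imageDegreeLE_mul {u : MvPolynomial σ K →ₐ[K] A} {X G : Submodule K A} {M : ℕ}
    (hG : 1 ≤ G) (hX : X * G ≤ imageDegreeLE u M * G) (n : ℕ) :
    X ^ n ≤ imageDegreeLE u (M * n) * G := by
  suffices X ^ n * G ≤ imageDegreeLE u (M * n) * G from (le_mul_of_one_le_right' hG).trans this
  induction n with
  | zero =>
    have hone : (1 : Submodule K A) ≤ imageDegreeLE u 0 :=
      Submodule.one_le.mpr (map_one u ▸ map_mem_imageDegreeLE u totalDegree_one.le)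
    simpa using mul_le_mul' hone le_rfl
  | succ n ih =>
    calc X ^ (n + 1) * G = X ^ n * (X * G) := by rw [pow_succ, mul_assoc]
      _ ≤ X ^ n * (imageDegreeLE u M * G) := by gcongr
      _ = imageDegreeLE u M * (X ^ n * G) := mul_left_comm _ _ _
      _ ≤ imageDegreeLE u M * (imageDegreeLE u (M * n) * G) := by gcongr
      _ = imageDegreeLE u M * imageDegreeLE u (M * n) * G := (mul_assoc _ _ _).symm
      _ ≤ imageDegreeLE u (M + M * n) * G := by gcongr; exact imageDegreeLE_mul_le u _ _
      _ = imageDegreeLE u (M * (n + 1)) * G := by rw [mul_add_one, add_comm]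

theorem finrank_imageDegreeLE_isBigO [Finite σ] [Fintype τ] (u : MvPolynomial σ K →ₐ[K] A)
    {g : MvPolynomial τ K →ₐ[K] A} (hg : g.Finite) :
    (fun n => (Module.finrank K (imageDegreeLE u n) : ℝ)) =O[atTop]
      fun n : ℕ => (n : ℝ) ^ Fintype.card τ := by
  obtain ⟨G, hGfg, hG, hle⟩ := exists_fg_forall_fg_le_imageDegreeLE_mul hg
  obtain ⟨M, hM⟩ := hle (imageDegreeLE u 1 * G) ((Module.Finite.iff_fg.mp inferInstance).mul hGfg)
  have : Module.Finite K G := Module.Finite.iff_fg.mpr hGfg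
  set s := Fintype.card τ
  refine IsBigO.of_bound ((M + s) ^ s * Module.finrank K G : ℕ) ?_
  filter_upwards [eventually_ge_atTop 1] with n hn
  have : Module.Finite K (imageDegreeLE g (M * n) * G : Submodule K A) :=
    Module.Finite.iff_fg.mpr ((Module.Finite.iff_fg.mp inferInstance).mul hGfg)
  rw [Real.norm_natCast, norm_pow, Real.norm_natCast]
  norm_cast
  calc Module.finrank K (imageDegreeLE u n)
      ≤ Module.finrank K (imageDegreeLE g (M * n) * G : Submodule K A) :=
        Submodule.finrank_mono
          ((imageDegreeLE_le_pow u n).trans (pow_le_imageDegreeLE_mul hG hM n))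
    _ ≤ Module.finrank K (imageDegreeLE g (M * n)) * Module.finrank K G := finrank_mul_le _ _
    _ ≤ (M * n + s) ^ s * Module.finrank K G := by gcongr; exact finrank_imageDegreeLE_le g _
    _ ≤ ((M + s) * n) ^ s * Module.finrank K G := by
        gcongr
        rw [add_mul]
        gcongr
        exact Nat.le_mul_of_pos_right s hn
    _ = (M + s) ^ s * Module.finrank K G * n ^ s := by rw [mul_pow]; ring

lemma trdeg_eq_card_of_finite_of_injective [IsDomain A] [Fintype τ] {g : MvPolynomial τ K →ₐ[K] A}
    (hg : g.Finite) (hinj : Function.Injective g) : Algebra.trdeg K A = Fintype.card τ := by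
  algebraize [g.toRingHom]
  have : FaithfulSMul (MvPolynomial τ K) A := (faithfulSMul_iff_algebraMap_injective _ _).mpr hinj
  have : Module.Finite (MvPolynomial τ K) A := hg
  have hadd := lift_trdeg_add_eq K (MvPolynomial τ K) A
  rw [show Algebra.trdeg (MvPolynomial τ K) A = 0 from trdeg_eq_zero,
    MvPolynomial.trdeg_of_isDomain] at hadd
  simpa [eq_comm] using hadd

end UpperBound

section Relations

open MvPolynomial

lemma exists_forall_aeval_eq_zero_iff_dvd {R A : Type*} [CommRing R] [IsDomain R]
    [UniqueFactorizationMonoid R] [CommRing A] [IsDomain A] [Algebra R A] [FaithfulSMul R A]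
    {a : A} (ha : IsAlgebraic R a) :
    ∃ F : Polynomial R, F ≠ 0 ∧ ∀ G, Polynomial.aeval a G = 0 ↔ F ∣ G := by
  obtain ⟨P, hP0, hP⟩ := ha
  obtain ⟨F, hF, hprime⟩ :=
    (RingHom.ker_isPrime (Polynomial.aeval a : Polynomial R →ₐ[R] A)).exists_mem_prime_of_ne_bot
      fun hbot => hP0 ((Submodule.eq_bot_iff _).mp hbot P hP)
  have hdeg : F.natDegree ≠ 0 := fun h0 => hprime.ne_zero <| by
    rw [Polynomial.eq_C_of_natDegree_eq_zero h0, RingHom.mem_ker, Polynomial.aeval_C,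
      FaithfulSMul.algebraMap_eq_zero_iff] at hF
    rw [Polynomial.eq_C_of_natDegree_eq_zero h0, hF, map_zero]
  have hprim : F.IsPrimitive := hprime.irreducible.isPrimitive hdeg
  refine ⟨F, hprime.ne_zero, fun G => ⟨fun hG => ?_, fun h => Ideal.mem_of_dvd _ h hF⟩⟩
  have : Nonempty (GCDMonoid R) := ⟨UniqueFactorizationMonoid.toGCDMonoid R⟩
  let _ := FractionRing.liftAlgebra R (FractionRing A)
  have haeval (H : Polynomial R) (hH : Polynomial.aeval a H = 0) :
      Polynomial.aeval (algebraMap A (FractionRing A) a)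
        (H.map (algebraMap R (FractionRing R))) = 0 := by
    rw [Polynomial.aeval_map_algebraMap, Polynomial.aeval_algebraMap_apply, hH, map_zero]
  have hirr := (hprim.irreducible_iff_irreducible_map_fraction_map
    (K := FractionRing R)).mp hprime.irreducible
  refine hprim.dvd_of_fraction_map_dvd_fraction_map (K := FractionRing R) ?_
  refine Dvd.dvd.trans ?_ (minpoly.dvd (FractionRing R) _ (haeval G hG))
  rw [← minpoly.eq_of_irreducible hirr (haeval F hF)]
  exact Dvd.intro _ rfl

lemma exists_forall_eq_zero_iff_dvd {τ K A : Type*} [Field K] [CommRing A] [IsDomain A]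
    [Algebra K A] {w : MvPolynomial (Option τ) K →ₐ[K] A}
    (hsome : Function.Injective (w.comp (rename some))) (hw : ¬ Function.Injective w) :
    ∃ F, F ≠ 0 ∧ ∀ G, w G = 0 ↔ F ∣ G := by
  algebraize [(w.comp (rename some)).toRingHom]
  have : FaithfulSMul (MvPolynomial τ K) A :=
    (faithfulSMul_iff_algebraMap_injective _ _).mpr hsome
  let E := optionEquivLeft K τ
  have haeval (G : MvPolynomial (Option τ) K) : Polynomial.aeval (w (X none)) (E G) = w G := by
    have hhom : ((Polynomial.aeval (R := MvPolynomial τ K) (w (X none))).restrictScalars K).comp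
        E.toAlgHom = w := by
      ext (_ | i)
      · simp [E]
      · simpa [E] using
          DFunLike.congr_fun (RingHom.algebraMap_toAlgebra (w.comp (rename some)).toRingHom) (X i)
    exact DFunLike.congr_fun hhom G
  obtain ⟨P, hP, hP0⟩ : ∃ P, w P = 0 ∧ P ≠ 0 := by
    simpa [injective_iff_map_eq_zero] using hw
  obtain ⟨F, hF0, hF⟩ := exists_forall_aeval_eq_zero_iff_dvd (R := MvPolynomial τ K)
    (a := w (X none)) ⟨E P, (map_ne_zero_iff E E.injective).mpr hP0, (haeval P).trans hP⟩
  refine ⟨E.symm F, (map_ne_zero_iff E.symm E.symm.injective).mpr hF0, fun G => ?_⟩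
  rw [← haeval, hF, ← map_dvd_iff E.symm, E.symm_apply_apply]

lemma finrank_restrictTotalDegree_le_add {σ K A : Type*} [Finite σ] [Field K] [CommRing A]
    [Algebra K A] {w : MvPolynomial σ K →ₐ[K] A} {F : MvPolynomial σ K} (hF0 : F ≠ 0)
    (hF : ∀ G, w G = 0 → F ∣ G) (n : ℕ) :
    Module.finrank K (restrictTotalDegree σ K (n + F.totalDegree)) ≤
      Module.finrank K (imageDegreeLE w (n + F.totalDegree)) +
        Module.finrank K (restrictTotalDegree σ K n) := by
  set M := restrictTotalDegree σ K (n + F.totalDegree) with hM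
  have hker : Module.finrank K (LinearMap.ker (w.toLinearMap.domRestrict M)) ≤
      Module.finrank K (restrictTotalDegree σ K n) := by
    rw [← Submodule.finrank_map_subtype_eq]
    refine (Submodule.finrank_mono ?_).trans (Submodule.finrank_map_le (LinearMap.mulLeft K F) _)
    rintro _ ⟨⟨g, hg⟩, hg0, rfl⟩
    obtain ⟨q, rfl⟩ := hF g hg0
    refine ⟨q, (mem_restrictTotalDegree _ _ _).mpr ?_, rfl⟩
    rcases eq_or_ne q 0 with rfl | hq
    · exact totalDegree_zero.trans_le n.zero_le
    rw [hM, mem_restrictTotalDegree, totalDegree_mul_of_isDomain hF0 hq, add_comm] at hg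
    exact Nat.add_le_add_iff_right.mp hg
  have hrank := LinearMap.finrank_range_add_finrank_ker (w.toLinearMap.domRestrict M)
  rw [LinearMap.range_domRestrict] at hrank
  rw [← hrank]
  exact Nat.add_le_add_left hker _

lemma mul_choose_add_choose_le (n e s : ℕ) :
    e * (n + s).choose s + (n + (s + 1)).choose n ≤ (n + e + (s + 1)).choose (n + e) := by
  induction e with
  | zero => simp
  | succ e ih =>
    have hmono : (n + s).choose s ≤ (n + e + (s + 1)).choose (n + e + 1) := by
      rw [show n + e + (s + 1) = (n + e + 1) + s by ring, Nat.choose_symm_add]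
      exact Nat.choose_le_choose s (by omega)
    have hpascal : (n + (e + 1) + (s + 1)).choose (n + (e + 1)) =
        (n + e + (s + 1)).choose (n + e) + (n + e + (s + 1)).choose (n + e + 1) := by
      rw [← Nat.choose_succ_succ']
      congr 1
      ring
    rw [hpascal, add_mul, one_mul]
    omega

lemma totalDegree_rename_of_injective {σ τ R : Type*} [CommSemiring R] {c : σ → τ}
    (hc : Function.Injective c) (f : MvPolynomial σ R) :
    (rename c f).totalDegree = f.totalDegree := by
  rw [← weightedTotalDegree_one, ← weightedTotalDegree_one,
    weightedTotalDegree_rename_of_injective hc]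
  rfl

variable {σ K A : Type*} [Field K] [CommRing A] [IsDomain A] [Algebra K A]
  {u : MvPolynomial σ K →ₐ[K] A} {s : ℕ}

lemma exists_isTranscendenceBasis_comp_X (hu : Function.Surjective u)
    (hs : Algebra.trdeg K A = s) :
    ∃ c : Fin s → σ, IsTranscendenceBasis K (fun k => u (X (c k))) := by
  have hrange : Algebra.adjoin K (Set.range fun i => u (X i)) = ⊤ := by
    rw [← (AlgHom.range_eq_top u).mpr hu, ← Algebra.map_top, ← adjoin_range_X, AlgHom.map_adjoin,
      ← Set.range_comp]
    rfl
  have : Algebra.IsAlgebraic (Algebra.adjoin K (Set.range fun i => u (X i))) A :=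
    ⟨fun a => isAlgebraic_algebraMap (⟨a, hrange ▸ Algebra.mem_top⟩ : Algebra.adjoin K _)⟩
  obtain ⟨T, hT, hbasis⟩ :=
    exists_isTranscendenceBasis_subset (R := K) (Set.range fun i => u (X i))
  choose c hc using fun t : T => hT t.2
  obtain ⟨ε⟩ : Nonempty (Fin s ≃ T) :=
    Cardinal.lift_mk_eq'.mp (by simp [hbasis.cardinalMk_eq_trdeg, hs])
  refine ⟨c ∘ ε, ?_⟩
  convert! hbasis.comp_equiv ε using 1
  exact funext fun k => hc _

lemma exists_option_injective_and_not_injective (hu : Function.Surjective u)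
    (hker : ¬ Function.Injective u) (hs : Algebra.trdeg K A = s) :
    ∃ c : Option (Fin s) → σ, Function.Injective c ∧
      Function.Injective ((u.comp (rename c)).comp (rename some)) ∧
      ¬ Function.Injective (u.comp (rename c)) := by
  obtain ⟨c, hc⟩ := exists_isTranscendenceBasis_comp_X hu hs
  have hcinj : Function.Injective c := Function.Injective.of_comp (f := fun i => u (X i))
    hc.1.injective
  obtain ⟨j, hj⟩ : ∃ j, j ∉ Set.range c := by
    by_contra! hsurj
    let ε := Equiv.ofBijective c ⟨hcinj, hsurj⟩
    refine hker ?_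
    rw [aeval_unique u, ← algebraicIndependent_iff_injective_aeval]
    exact (algebraicIndependent_equiv' ε rfl).mp hc.1
  refine ⟨fun o => o.elim j c, Option.injective_iff.mpr ⟨hcinj, hj⟩, ?_, fun hinj => ?_⟩
  · have hcomp : (u.comp (rename fun o : Option (Fin s) => o.elim j c)).comp (rename some) =
        aeval fun k => u (X (c k)) := by
      ext k
      simp
    exact hcomp ▸ hc.1
  · have hcomp : u.comp (rename fun o : Option (Fin s) => o.elim j c) =
        aeval fun o => o.elim (u (X j)) fun k => u (X (c k)) := by
      ext (_ | k) <;> simp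
    rw [hcomp, ← algebraicIndependent_iff_injective_aeval, hc.1.option_iff_transcendental] at hinj
    have := hc.isAlgebraic
    exact hinj (Algebra.IsAlgebraic.isAlgebraic _)

theorem exists_forall_mul_choose_le_finrank_imageDegreeLE [Finite σ] (hu : Function.Surjective u)
    (hker : ¬ Function.Injective u) (hs : Algebra.trdeg K A = s) :
    ∃ F, F ≠ 0 ∧ u F = 0 ∧ ∀ n, F.totalDegree * (n + s).choose s ≤
      Module.finrank K (imageDegreeLE u (n + F.totalDegree)) := by
  obtain ⟨c, hc, hsome, hnot⟩ := exists_option_injective_and_not_injective hu hker hs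
  obtain ⟨F, hF0, hF⟩ := exists_forall_eq_zero_iff_dvd hsome hnot
  refine ⟨rename c F, (map_ne_zero_iff _ (rename_injective c hc)).mpr hF0, (hF F).mpr dvd_rfl,
    fun n => ?_⟩
  rw [totalDegree_rename_of_injective hc]
  refine le_trans ?_ (Submodule.finrank_mono (imageDegreeLE_comp_rename_le u c _))
  have hcount := finrank_restrictTotalDegree_le_add hF0 (fun G => (hF G).mp) n
  rw [finrank_restrictTotalDegree, finrank_restrictTotalDegree, Fintype.card_option,
    Fintype.card_fin] at hcount
  have hchoose := mul_choose_add_choose_le n F.totalDegree s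
  omega

end Relations

section HomogeneousKernel

open MvPolynomial Filter

variable {σ K A : Type*} [Field K] [CommRing A] [Algebra K A]

/-- The elements of an algebra which are values of forms of degree `n` in a given family of
elements, the family being encoded by its evaluation map `u`. For a homogeneous coordinate ring,
these are its graded pieces. -/
noncomputable def imageForms (u : MvPolynomial σ K →ₐ[K] A) (n : ℕ) : Submodule K A :=
  (homogeneousSubmodule σ K n).map u.toLinearMap

instance [Finite σ] (u : MvPolynomial σ K →ₐ[K] A) (n : ℕ) : Module.Finite K (imageForms u n) :=
  Module.Finite.iff_fg.mpr ((homogeneousSubmodule_fg σ K n).map _)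

lemma imageDegreeLE_zero (u : MvPolynomial σ K →ₐ[K] A) : imageDegreeLE u 0 = imageForms u 0 := by
  rw [imageDegreeLE, imageForms]
  congr 1
  ext f
  rw [mem_restrictTotalDegree, mem_homogeneousSubmodule, Nat.le_zero,
    totalDegree_zero_iff_isHomogeneous]

lemma imageDegreeLE_succ (u : MvPolynomial σ K →ₐ[K] A) (n : ℕ) :
    imageDegreeLE u (n + 1) = imageDegreeLE u n ⊔ imageForms u (n + 1) := by
  rw [imageDegreeLE, imageDegreeLE, imageForms, ← Submodule.map_sup]
  congr 1
  refine le_antisymm (fun f hf => ?_) (sup_le (restrictTotalDegree_mono n.le_succ)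
    (homogeneousSubmodule_le_restrictTotalDegree _))
  rw [mem_restrictTotalDegree] at hf
  rcases hf.lt_or_eq with hlt | heq
  · exact Submodule.mem_sup_left
      ((mem_restrictTotalDegree _ _ _).mpr (Nat.le_of_lt_succ hlt))
  rw [← sum_homogeneousComponent f, heq, Finset.sum_range_succ]
  refine Submodule.add_mem_sup (Submodule.sum_mem _ fun m hm => ?_) (homogeneousComponent_mem _ _)
  exact restrictTotalDegree_mono (Nat.le_of_lt_succ (Finset.mem_range.mp hm))
    (homogeneousSubmodule_le_restrictTotalDegree m (homogeneousComponent_mem m f))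

attribute [local instance] MvPolynomial.gradedAlgebra

variable {u : MvPolynomial σ K →ₐ[K] A}

lemma disjoint_imageDegreeLE_imageForms
    (hom : (RingHom.ker u).IsHomogeneous (homogeneousSubmodule σ K)) (n : ℕ) :
    Disjoint (imageDegreeLE u n) (imageForms u (n + 1)) := by
  rw [Submodule.disjoint_def]
  rintro _ ⟨f, hf, rfl⟩ ⟨g, hg, hgf⟩
  have hmem : g - f ∈ RingHom.ker u := by
    rw [RingHom.mem_ker, map_sub, sub_eq_zero]
    exact hgf
  have hgker := homogeneousComponent_mem_of_mem hom hmem (n + 1)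
  have hf' := (mem_restrictTotalDegree _ _ _).mp hf
  rw [map_sub, homogeneousComponent_eq_self hg,
    homogeneousComponent_eq_zero _ _ (Nat.lt_succ_of_le hf'), sub_zero] at hgker
  exact hgf.symm.trans hgker

lemma sum_finrank_imageForms [Finite σ]
    (hom : (RingHom.ker u).IsHomogeneous (homogeneousSubmodule σ K)) (n : ℕ) :
    ∑ m ∈ Finset.range (n + 1), Module.finrank K (imageForms u m) =
      Module.finrank K (imageDegreeLE u n) := by
  induction n with
  | zero => rw [Finset.sum_range_one, imageDegreeLE_zero]
  | succ n ih =>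
    rw [Finset.sum_range_succ, ih, imageDegreeLE_succ, ← Submodule.finrank_sup_add_finrank_inf_eq,
      (disjoint_imageDegreeLE_imageForms hom n).eq_bot, finrank_bot, add_zero]

lemma eval_zero_of_mem_ker [Nontrivial A]
    (hom : (RingHom.ker u).IsHomogeneous (homogeneousSubmodule σ K))
    {F : MvPolynomial σ K} (hF : F ∈ RingHom.ker u) : eval 0 F = 0 := by
  have hcoeff := homogeneousComponent_mem_of_mem hom hF 0
  rw [homogeneousComponent_zero, RingHom.mem_ker, ← algebraMap_eq, AlgHom.commutes,
    FaithfulSMul.algebraMap_eq_zero_iff] at hcoeff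
  rw [eval_zero, constantCoeff_eq, hcoeff]

lemma finrank_imageForms_ne_zero [Finite σ] [IsReduced A] {i : σ} (hi : u (X i) ≠ 0) (n : ℕ) :
    Module.finrank K (imageForms u n) ≠ 0 := fun h => by
  have hmem : u (X i ^ n) ∈ imageForms u n := ⟨_, isHomogeneous_X_pow i n, rfl⟩
  rw [Submodule.finrank_eq_zero.mp h, Submodule.mem_bot, map_pow] at hmem
  exact hi (eq_zero_of_pow_eq_zero hmem)

lemma exists_finrank_imageDegreeLE_isBigO [Finite σ] [IsDomain A] (hu : Function.Surjective u) :
    ∃ s : ℕ, Algebra.trdeg K A = s ∧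
      (fun n => (Module.finrank K (imageDegreeLE u n) : ℝ)) =O[atTop] fun n : ℕ => (n : ℝ) ^ s := by
  have : Algebra.FiniteType K A := Algebra.FiniteType.of_surjective u hu
  obtain ⟨s, g, hinj, hfin⟩ := exists_finite_inj_algHom_of_fg K A
  have htrdeg := trdeg_eq_card_of_finite_of_injective hfin hinj
  have hbigO := finrank_imageDegreeLE_isBigO u hfin
  rw [Fintype.card_fin] at htrdeg hbigO
  exact ⟨s, htrdeg, hbigO⟩

theorem exists_mem_ker_totalDegree_le [Finite σ] [IsDomain A] (hu : Function.Surjective u)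
    (hker : ¬ Function.Injective u)
    (hom : (RingHom.ker u).IsHomogeneous (homogeneousSubmodule σ K))
    {i : σ} (hi : u (X i) ≠ 0) {p : Polynomial ℚ}
    (hp : ∀ᶠ n : ℕ in atTop, (Module.finrank K (imageForms u n) : ℚ) = p.eval (n : ℚ)) :
    ∃ F ∈ RingHom.ker u, F ≠ 0 ∧ (F.totalDegree : ℚ) ≤ p.leadingCoeff * p.natDegree ! := by
  have hp0 : p ≠ 0 := by
    rintro rfl
    obtain ⟨n, hn⟩ := hp.exists
    rw [Polynomial.eval_zero, Nat.cast_eq_zero] at hn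
    exact finrank_imageForms_ne_zero hi n hn
  obtain ⟨s, hs, hupper⟩ := exists_finrank_imageDegreeLE_isBigO hu
  obtain ⟨F, hF0, hF, hlower⟩ := exists_forall_mul_choose_le_finrank_imageDegreeLE hu hker hs
  simp only [← sum_finrank_imageForms hom, Nat.cast_sum] at hupper hlower
  set q := p.map (algebraMap ℚ ℝ)
  have hq : ∀ᶠ n : ℕ in atTop, (Module.finrank K (imageForms u n) : ℝ) = q.eval (n : ℝ) := by
    filter_upwards [hp] with n hn
    rw [Polynomial.eval_natCast_map, ← hn, map_natCast]
  have hlt := natDegree_lt_of_sum_range_isBigO (Polynomial.map_ne_zero hp0) hq hupper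
  have hle := le_leadingCoeff_mul_factorial_of_le_sum_range (e := F.totalDegree) hq hlt
    fun n => by exact_mod_cast hlower n
  rw [Polynomial.leadingCoeff_map, Polynomial.natDegree_map, eq_ratCast] at hle
  exact ⟨F, hF, hF0, by exact_mod_cast hle⟩

end HomogeneousKernel

section Nullstellensatz

open MvPolynomial

lemma exists_natCast_eval_ne_zero {σ K : Type*} [Fintype σ] [Field K] [CharZero K]
    {F : MvPolynomial σ K} (hF : F ≠ 0) :
    ∃ a : σ → ℕ, ∑ i, a i ≤ F.totalDegree ∧ eval (fun i => (a i : K)) F ≠ 0 := by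
  classical
  obtain ⟨t, ht, htd⟩ : ∃ t ∈ F.support, F.totalDegree = t.degree :=
    Finset.exists_mem_eq_sup _ (support_nonempty.mpr hF) _
  obtain ⟨x, hx, hxF⟩ := combinatorial_nullstellensatz_exists_eval_nonzero F t
    (mem_support_iff.mp ht) htd
    (fun i => (Finset.range (t i + 1)).image (Nat.cast : ℕ → K)) fun i => by
      rw [Finset.card_image_of_injective _ Nat.cast_injective, Finset.card_range]
      exact Nat.lt_succ_self _
  choose a ha hax using fun i => Finset.mem_image.mp (hx i)
  refine ⟨a, ?_, by simpa only [hax] using hxF⟩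
  rw [htd, Finsupp.degree_eq_sum]
  exact Finset.sum_le_sum fun i _ => Nat.le_of_lt_succ (Finset.mem_range.mp (ha i))

end Nullstellensatz

namespace CoordRing

variable {K W ι : Type*} [Field K] [AddCommGroup W] [Module K W] [Fintype ι] [DecidableEq ι]
  (b : Module.Basis ι K W)

/-- The homogeneous coordinate ring of the projective space of lines in `W`, as the polynomial ring
in the coordinates with respect to a basis of `W`. -/
noncomputable def equivMvPolynomial : CoordRing K W ≃ₐ[K] MvPolynomial ι K :=
  SymmetricAlgebra.equivMvPolynomial b.dualBasis

lemma equivMvPolynomial_symm_X (i : ι) :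
    (equivMvPolynomial b).symm (MvPolynomial.X i) =
      SymmetricAlgebra.ι K (Module.Dual K W) (b.dualBasis i) :=
  SymmetricAlgebra.equivMvPolynomial_symm_X _ _

lemma evalAt_equivMvPolynomial_symm (w : W) (F : MvPolynomial ι K) :
    evalAt w ((equivMvPolynomial b).symm F) = MvPolynomial.eval (b.repr w) F := by
  have hhom : (evalAt w).comp (equivMvPolynomial b).symm.toAlgHom =
      MvPolynomial.aeval (b.repr w) := by
    ext i
    simp [equivMvPolynomial_symm_X, evalAt]
  rw [← MvPolynomial.coe_aeval_eq_eval]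
  exact DFunLike.congr_fun hhom F

lemma forms_eq_map_homogeneousSubmodule (n : ℕ) :
    forms K W n = (MvPolynomial.homogeneousSubmodule ι K n).map
      (equivMvPolynomial b).symm.toAlgHom.toLinearMap := by
  rw [← MvPolynomial.homogeneousSubmodule_one_pow, Submodule.map_pow, forms,
    MvPolynomial.homogeneousSubmodule_one_eq_span_X, Submodule.map_span, ← Set.range_comp,
    LinearMap.range_eq_map, ← b.dualBasis.span_eq, Submodule.map_span, ← Set.range_comp]
  congr 3
  exact funext fun i => (equivMvPolynomial_symm_X b i).symm

end CoordRing

namespace ProjSubvariety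

section Dimension

variable {K W : Type*} [Field K] [AddCommGroup W] [Module K W] {Z : ProjSubvariety K W}

lemma IsProper.exists_form_ne_zero (hZ : Z.IsProper) :
    ∃ f ∈ Z.ideal, f ≠ 0 ∧ ∃ n, f ∈ CoordRing.forms K W n := by
  by_contra! hzero
  refine hZ (Z.homogeneous.trans (Ideal.span_eq_bot.mpr ?_))
  rintro f ⟨hf, n, hn⟩
  by_contra hf0
  exact hzero f hf hf0 n hn

lemma IsProper.one_lt_finrank [Module.Finite K W] (hZ : Z.IsProper) : 1 < Module.finrank K W := by
  by_contra! hle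
  rw [← Subspace.dual_finrank_eq (K := K), finrank_le_one_iff] at hle
  obtain ⟨l, hl⟩ := hle
  have hrange : LinearMap.range (SymmetricAlgebra.ι K (Module.Dual K W)) =
      Submodule.span K {SymmetricAlgebra.ι K (Module.Dual K W) l} := by
    rw [LinearMap.range_eq_map, ← Set.image_singleton, ← Submodule.map_span,
      Submodule.eq_top_iff'.mpr fun l' => Submodule.mem_span_singleton.mpr (hl l')]
  obtain ⟨f, hf, hf0, n, hn⟩ := hZ.exists_form_ne_zero
  rw [CoordRing.forms, hrange, Submodule.span_pow, Set.singleton_pow,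
    Submodule.mem_span_singleton] at hn
  obtain ⟨c, rfl⟩ := hn
  have hc : c ≠ 0 := fun h => hf0 (by rw [h, zero_smul])
  have hmem : SymmetricAlgebra.ι K (Module.Dual K W) l ∈ Z.ideal :=
    Z.isPrime.mem_of_pow_mem n ((Submodule.smul_mem_iff (Z.ideal.restrictScalars K) hc).mp hf)
  obtain ⟨l', hl'⟩ := Z.relevant
  obtain ⟨c', rfl⟩ := hl l'
  rw [map_smul] at hl'
  exact hl' (Submodule.smul_of_tower_mem Z.ideal c' hmem)

end Dimension

section Coordinates

variable {K W ι : Type*} [Field K] [AddCommGroup W] [Module K W] [Fintype ι] [DecidableEq ι]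
  (Z : ProjSubvariety K W) (b : Module.Basis ι K W)

/-- The homogeneous coordinate ring of a subvariety, as the quotient of the polynomial ring in the
coordinates with respect to a basis of `W`. -/
noncomputable def coordHom : MvPolynomial ι K →ₐ[K] CoordRing K W ⧸ Z.ideal :=
  (Ideal.Quotient.mkₐ K Z.ideal).comp (CoordRing.equivMvPolynomial b).symm.toAlgHom

lemma coordHom_eq_zero_iff (F : MvPolynomial ι K) :
    Z.coordHom b F = 0 ↔ (CoordRing.equivMvPolynomial b).symm F ∈ Z.ideal :=
  Ideal.Quotient.eq_zero_iff_mem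

lemma coordHom_surjective : Function.Surjective (Z.coordHom b) :=
  (Ideal.Quotient.mkₐ_surjective K Z.ideal).comp (CoordRing.equivMvPolynomial b).symm.surjective

variable {Z} in
lemma IsProper.not_injective_coordHom (hZ : Z.IsProper) :
    ¬ Function.Injective (Z.coordHom b) := by
  obtain ⟨f, hf, hf0⟩ := Submodule.exists_mem_ne_zero_of_ne_bot hZ
  intro hinj
  refine hf0 ((map_eq_zero_iff _ (CoordRing.equivMvPolynomial b).injective).mp (hinj ?_))
  rwa [map_zero, coordHom_eq_zero_iff, AlgEquiv.symm_apply_apply]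

lemma exists_coordHom_X_ne_zero : ∃ i, Z.coordHom b (MvPolynomial.X i) ≠ 0 := by
  by_contra! h
  obtain ⟨l, hl⟩ := Z.relevant
  refine hl ?_
  rw [← b.dualBasis.sum_repr l, map_sum]
  refine Z.ideal.sum_mem fun i _ => ?_
  rw [map_smul, ← CoordRing.equivMvPolynomial_symm_X]
  exact Submodule.smul_of_tower_mem _ _ ((Z.coordHom_eq_zero_iff b _).mp (h i))

lemma hilbertFunction_eq_finrank_imageForms (n : ℕ) :
    Z.hilbertFunction n = Module.finrank K (imageForms (Z.coordHom b) n) := by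
  rw [hilbertFunction, CoordRing.forms_eq_map_homogeneousSubmodule b, ← Submodule.map_comp]
  rfl

attribute [local instance] MvPolynomial.gradedAlgebra

lemma ker_coordHom_isHomogeneous : (RingHom.ker (Z.coordHom b)).IsHomogeneous
    (MvPolynomial.homogeneousSubmodule ι K) := by
  let E := (CoordRing.equivMvPolynomial b).toRingEquiv
  have hker : RingHom.ker (Z.coordHom b) = Z.ideal.map E := by
    rw [← Ideal.comap_symm]
    ext F
    exact Z.coordHom_eq_zero_iff b F
  rw [hker, Z.homogeneous, Ideal.map_span]
  refine Ideal.homogeneous_span _ _ ?_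
  rintro _ ⟨f, ⟨-, m, hm⟩, rfl⟩
  rw [CoordRing.forms_eq_map_homogeneousSubmodule b] at hm
  obtain ⟨g, hg, rfl⟩ := hm
  exact ⟨m, (E.apply_symm_apply g).symm ▸ hg⟩

variable {Z}

lemma IsProper.exists_mem_ideal_totalDegree_le (hZ : Z.IsProper) {D : ℕ} (hD : Z.HasDegree D) :
    ∃ F : MvPolynomial ι K, (CoordRing.equivMvPolynomial b).symm F ∈ Z.ideal ∧ F ≠ 0 ∧
      F.totalDegree ≤ D ∧ MvPolynomial.eval 0 F = 0 := by
  have := Z.isPrime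
  obtain ⟨p, hp, hpD⟩ := hD
  simp only [Z.hilbertFunction_eq_finrank_imageForms b] at hp
  obtain ⟨i, hi⟩ := Z.exists_coordHom_X_ne_zero b
  obtain ⟨F, hF, hF0, hFD⟩ := exists_mem_ker_totalDegree_le (Z.coordHom_surjective b)
    (hZ.not_injective_coordHom b) (Z.ker_coordHom_isHomogeneous b) hi hp
  rw [hpD, Nat.cast_le] at hFD
  exact ⟨F, (Z.coordHom_eq_zero_iff b F).mp hF, hF0, hFD,
    eval_zero_of_mem_ker (Z.ker_coordHom_isHomogeneous b) hF⟩

end Coordinates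

theorem IsProper.exists_sum_smul_notMem_rationalPoints {K W ι : Type*} [Field K] [CharZero K]
    [AddCommGroup W] [Module K W] [Fintype ι] {Z : ProjSubvariety K W} (hZ : Z.IsProper)
    (b : Module.Basis ι K W) {D : ℕ} (hD : Z.HasDegree D) :
    ∃ a : ι → ℕ, ∑ i, a i ≤ D ∧ ∃ hv : ∑ i, a i • b i ≠ 0,
      Projectivization.mk K (∑ i, a i • b i) hv ∉ Z.rationalPoints := by
  classical
  obtain ⟨F, hF, hF0, hFD, hFzero⟩ := hZ.exists_mem_ideal_totalDegree_le b hD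
  obtain ⟨a, ha, haF⟩ := exists_natCast_eval_ne_zero hF0
  have hrepr : (b.repr (∑ i, a i • b i) : ι → K) = fun i => (a i : K) := by
    simp only [← Nat.cast_smul_eq_nsmul K, b.repr_sum_self]
  rw [← hrepr] at haF
  refine ⟨a, ha.trans hFD, fun hzero => ?_, fun hmem => ?_⟩
  · rw [hzero, map_zero, Finsupp.coe_zero] at haF
    exact haF hFzero
  · have heval := hmem _ hF (∑ i, a i • b i) <| by
      rw [Projectivization.submodule_mk]
      exact Submodule.mem_span_singleton_self _
    rw [CoordRing.evalAt_equivMvPolynomial_symm] at heval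
    exact haF heval

end ProjSubvariety

lemma ne_zero_of_sum_nsmul_ne_zero {ι V : Type*} [Fintype ι] [AddCommMonoid V] {a : ι → ℕ}
    {e : ι → V} (hv : ∑ i, a i • e i ≠ 0) {D : ℕ} (ha : ∑ i, a i ≤ D) : D ≠ 0 := by
  rintro rfl
  rw [Nat.le_zero, Finset.sum_eq_zero_iff] at ha
  exact hv (Finset.sum_eq_zero fun i hi => by rw [ha i hi, zero_smul])

section BaseChange

variable {R A V : Type*} [CommRing R] [CommRing A] [Algebra R A] [AddCommGroup V] [Module R V]

lemma one_tmul_injective [Module.Flat R V] (hinj : Function.Injective (algebraMap R A)) :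
    Function.Injective fun v : V => (1 : A) ⊗ₜ[R] v := by
  have hcomp : (fun v : V => (1 : A) ⊗ₜ[R] v) =
      (Algebra.linearMap R A).rTensor V ∘ (TensorProduct.lid R V).symm := by
    ext v
    simp
  rw [hcomp]
  exact (Module.Flat.rTensor_preserves_injective_linearMap _ hinj).comp
    (TensorProduct.lid R V).symm.injective

lemma one_tmul_sum_nsmul {ι : Type*} [Fintype ι] (a : ι → ℕ) (e : ι → V) :
    (1 : A) ⊗ₜ[R] (∑ i, a i • e i) = ∑ i, a i • ((1 : A) ⊗ₜ[R] e i) := by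
  simp only [TensorProduct.tmul_sum, TensorProduct.tmul_smul]

lemma exists_linearIndependent_one_tmul {K : Type*} [Field K] [Algebra R K] {n : ℕ}
    [Module.Finite K (K ⊗[R] V)] (hn : Module.finrank K (K ⊗[R] V) = n) :
    ∃ e : Fin n → V, LinearIndependent K fun i => (1 : K) ⊗ₜ[R] e i := by
  have hspan : Submodule.span K (Set.range fun v : V => (1 : K) ⊗ₜ[R] v) = ⊤ := by
    rw [← Submodule.baseChange_top, Submodule.baseChange_eq_span, Submodule.map_top]
    rfl
  have hdim := hn
  rw [← finrank_top, ← hspan] at hdim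
  obtain ⟨f, hf, -, hind⟩ :=
    Submodule.exists_fun_fin_finrank_span_eq K (Set.range fun v : V => (1 : K) ⊗ₜ[R] v)
  choose e he using hf
  refine ⟨e ∘ Fin.cast hdim.symm, ?_⟩
  rw [← funext he] at hind
  exact hind.comp _ (Fin.cast_injective _)

end BaseChange

namespace HermitianMetric

section Norm

variable {K V : Type*} [Field K] [AddCommGroup V] [Module (𝓞 K) V]
  (h : HermitianMetric K V) (σ : K →+* ℂ)

lemma norm_sum_nsmul_le {ι : Type*} [Fintype ι] (a : ι → ℕ) (e : ι → V) :
    h.norm σ (∑ i, a i • e i) ≤ ∑ i, (a i : ℝ) * h.norm σ (e i) := by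
  let := @InnerProductSpace.Core.toNormedAddCommGroup ℂ (ComplexFiber σ V) _ _ _ (h.form σ)
  have hnorm (v : V) : h.norm σ v = ‖(1 : ComplexAt σ) ⊗ₜ[𝓞 K] v‖ := rfl
  simp only [hnorm, one_tmul_sum_nsmul]
  exact (norm_sum_le _ _).trans (Finset.sum_le_sum fun i _ => norm_nsmul_le)

lemma norm_pos [Module.Flat (𝓞 K) V] {v : V} (hv : v ≠ 0) : 0 < h.norm σ v := by
  let := @InnerProductSpace.Core.toNormedAddCommGroup ℂ (ComplexFiber σ V) _ _ _ (h.form σ)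
  have hinj : Function.Injective (algebraMap (𝓞 K) (ComplexAt σ)) :=
    σ.injective.comp (FaithfulSMul.algebraMap_injective (𝓞 K) K)
  have hne : (1 : ComplexAt σ) ⊗ₜ[𝓞 K] v ≠ 0 := fun h0 =>
    hv (one_tmul_injective hinj (h0.trans (TensorProduct.tmul_zero V 1).symm))
  exact norm_pos_iff.mpr hne

lemma log_norm_sum_nsmul_le [Module.Flat (𝓞 K) V] {ι : Type*} [Fintype ι] {a : ι → ℕ}
    {e : ι → V} (hv : ∑ i, a i • e i ≠ 0) {l : ℝ} (he : ∀ i, Real.log (h.norm σ (e i)) ≤ l)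
    {D : ℕ} (ha : ∑ i, a i ≤ D) :
    Real.log (h.norm σ (∑ i, a i • e i)) ≤ l + Real.log D := by
  have hnorm : h.norm σ (∑ i, a i • e i) ≤ Real.exp l * D := calc
    _ ≤ ∑ i, (a i : ℝ) * h.norm σ (e i) := h.norm_sum_nsmul_le σ a e
    _ ≤ ∑ i, (a i : ℝ) * Real.exp l := by
        gcongr with i
        exact (Real.le_exp_log _).trans (Real.exp_le_exp.mpr (he i))
    _ = Real.exp l * (∑ i, a i : ℕ) := by rw [← Finset.sum_mul, Nat.cast_sum, mul_comm]
    _ ≤ Real.exp l * D := by gcongr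
  refine (Real.log_le_log (h.norm_pos σ hv) hnorm).trans_eq ?_
  rw [Real.log_mul (Real.exp_pos l).ne'
    (Nat.cast_ne_zero.mpr <| ne_zero_of_sum_nsmul_ne_zero hv ha), Real.log_exp]

end Norm

lemma exists_linearIndependent_log_norm_le {K V : Type*} [Field K] [NumberField K]
    [AddCommGroup V] [Module (𝓞 K) V] (h : HermitianMetric K V) {n : ℕ}
    [Module.Finite K (K ⊗[𝓞 K] V)] (hn : Module.finrank K (K ⊗[𝓞 K] V) = n) {c : ℝ} (hc : 0 < c) :
    ∃ e : Fin n → V, LinearIndependent K (fun i => (1 : K) ⊗ₜ[𝓞 K] e i) ∧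
      ∀ i (σ : K →+* ℂ), Real.log (h.norm σ (e i)) ≤ h.successiveMinimum n + c := by
  obtain ⟨e₀, he₀⟩ := exists_linearIndependent_one_tmul hn
  obtain ⟨l₀, hl₀⟩ := (Set.finite_range fun x : Fin n × (K →+* ℂ) =>
    Real.log (h.norm x.2 (e₀ x.1))).bddAbove
  have hne : {l : ℝ | ∃ e : Fin n → V, LinearIndependent K (fun i => (1 : K) ⊗ₜ[𝓞 K] e i) ∧
      ∀ i (σ : K →+* ℂ), Real.log (h.norm σ (e i)) ≤ l}.Nonempty :=
    ⟨l₀, e₀, he₀, fun i σ => hl₀ ⟨(i, σ), rfl⟩⟩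
  obtain ⟨l, ⟨e, hind, hle⟩, hl⟩ :=
    exists_lt_of_csInf_lt hne (lt_add_of_pos_right (h.successiveMinimum n) hc)
  exact ⟨e, hind, fun i σ => (hle i σ).trans hl.le⟩

end HermitianMetric

theorem proposition5_general {K : Type*} [Field K] [NumberField K]
    {V : Type*} [AddCommGroup V] [Module (𝓞 K) V] [Module.Flat (𝓞 K) V]
    (N : ℕ) (hN : Module.finrank (𝓞 K) V = N + 1) (h : HermitianMetric K V)
    (Z : ProjSubvariety K (K ⊗[𝓞 K] V)) (hZ : Z.IsProper) (D : ℕ) (hD : Z.HasDegree D)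
    {c : ℝ} (hc : 1 < c) :
    ∃ v : V, v ≠ 0 ∧
      (∀ σ : K →+* ℂ,
        Real.log (h.norm σ v) ≤ h.successiveMinimum (N + 1) + Real.log ((D : ℝ) * c)) ∧
      ∃ hv : (1 : K) ⊗ₜ[𝓞 K] v ≠ 0,
        Projectivization.mk K ((1 : K) ⊗ₜ[𝓞 K] v) hv ∉ Z.rationalPoints := by
  have hrank : Module.finrank K (K ⊗[𝓞 K] V) = N + 1 :=
    (TensorProduct.isBaseChange (𝓞 K) V K).finrank_eq.trans hN
  have : Module.Finite K (K ⊗[𝓞 K] V) := Module.finite_of_finrank_eq_succ hrank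
  obtain ⟨e, hind, hle⟩ := h.exists_linearIndependent_log_norm_le hrank (Real.log_pos hc)
  let b := basisOfLinearIndependentOfCardEqFinrank hind (by rw [Fintype.card_fin, hrank])
  obtain ⟨a, haD, hsum, hmem⟩ := hZ.exists_sum_smul_notMem_rationalPoints b hD
  simp only [b, coe_basisOfLinearIndependentOfCardEqFinrank, ← one_tmul_sum_nsmul] at hsum hmem
  have hv : ∑ i, a i • e i ≠ 0 := fun h0 => hsum (by rw [h0, TensorProduct.tmul_zero])
  refine ⟨∑ i, a i • e i, hv, fun σ => ?_, hsum, hmem⟩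
  refine (h.log_norm_sum_nsmul_le σ hv (hle · σ) haD).trans_eq ?_
  have hD₀ : (D : ℝ) ≠ 0 := Nat.cast_ne_zero.mpr (ne_zero_of_sum_nsmul_ne_zero hv haD)
  rw [Real.log_mul hD₀ (zero_lt_one.trans hc).ne', add_assoc, add_comm (Real.log c)]

theorem proposition5 {K : Type*} [Field K] [NumberField K]
    {V : Type*} [AddCommGroup V] [Module (𝓞 K) V]
    [Module.Finite (𝓞 K) V] [Module.Projective (𝓞 K) V]
    (N : ℕ) (hN : Module.finrank (𝓞 K) V = N + 1)
    (h : HermitianMetric K V)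
    (Z : ProjSubvariety K (K ⊗[𝓞 K] V)) (hZ : Z.IsProper)
    (D : ℕ) (hD : Z.HasDegree D) :
    ∃ v : V, v ≠ 0 ∧
      (∀ σ : K →+* ℂ,
        Real.log (h.norm σ v) ≤
          h.successiveMinimum (N + 1) + Real.log ((D : ℝ) * ((N : ℝ) + 1))) ∧
      ∃ hv : (1 : K) ⊗ₜ[𝓞 K] v ≠ 0,
        Projectivization.mk K ((1 : K) ⊗ₜ[𝓞 K] v) hv ∉ Z.rationalPoints := by
  have hlt := hZ.one_lt_finrank
  rw [(TensorProduct.isBaseChange (𝓞 K) V K).finrank_eq, hN] at hlt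
  exact proposition5_general N hN h Z hZ D hD (c := N + 1) (mod_cast hlt)
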